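/- Let $(M,g)$ be a smooth Riemannian manifold of dimension $2n+s$ with Levi-Civita connection $\nabla$ and a framed metric $f$-structure $(f,\xi_i,\eta_i,g)$, $i=1,\dots,s$: $f$ is a smooth $(1,1)$-tensor field of rank $2n$, the $\xi_i$ are smooth vector fields and the $\eta_i$ are $1$-forms such that $$f^2=-I+\sum_i\eta_i\otimes\xi_i,\quad \eta_i(\xi_j)=\delta_{ij},\quad f\xi_i=0,\quad \eta_i\circ f=0,$$ $$g(fX,fY)=g(X,Y)-\sum_i\eta_i(X)\eta_i(Y),\quad \eta_i(X)=g(X,\xi_i).$$ Suppose that $M$ is a trans-$S$-manifold: there are smooth functions $\alpha_i,\beta_i$ on $M$ with $$(\nabla_Xf)Y=\sum_{i=1}^s\Big[\alpha_i\{g(fX,fY)\xi_i+\eta_i(Y)f^2X\}+\beta_i\{g(fX,Y)\xi_i-\eta_i(Y)fX\}\Big],$$ and $M$ is normal, $[f,f]+2\sum_i d\eta_i\otimes\xi_i=0$, where $[f,f]$ is the Nijenhuis torsion of $f$ and $2\,d\eta(X,Y)=X\eta(Y)-Y\eta(X)-\eta([X,Y])$. Let $J\subseteq\mathbb R$ be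 an interval with more than one point and let $\gamma:J\to M$ be a smooth unit-speed Legendre curve, i.e. $T=\gamma'$ satisfies $\eta_i(T)=0$ for all $i$. Suppose that $\nabla_TT=-q\,fT$ for a constant $q\neq0$, and put $\delta=\operatorname{sgn}(-q)$. Below, $\alpha_i$, $\beta_i$, $\xi_i$ are taken along $\gamma$, and a prime is the derivative with respect to the arc-length parameter. A unit-speed curve is a Frenet curve of osculating order $r\ge1$ if there are smooth orthonormal vector fields $E_1=T,E_2,\dots,E_r$ along it and positive functions $\kappa_1,\dots,\kappa_{r-1}$ with $\nabla_TE_j=-\kappa_{j-1}E_{j-1}+\kappa_jE_{j+1}$ for $1\le j\le r$, where the terms with $\kappa_0$ and $\kappa_r$ are absent; a circle is a Frenet curve of osculating order $2$ with $\kappa_1$ a positive constant. Then all $\beta_i$ vanish along $\gamma$. If all $\alpha_i$ vanish along $\gamma$, then $\gamma$ is a circle with Frenet frame $\{T,\delta fT\}$ and $\kappa_1=|q|$. Moreover, whenever $\gamma$ is a Frenet curve of some osculating order $r$, with frame $E_1,\dots,E_r$ and curvatures $\kappa_1,\dots,\kappa_{r-1}$, one has $r\ge2$, $\kappa_1=|q|$,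 $E_2=\delta fT$, and exactly one of the following holds. 1. $r=2$, so that $\gamma$ is a Legendre circle with Frenet frame $\{T,\delta fT\}$, and all $\alpha_i$ vanish along $\gamma$. 2. $r\ge3$; at every point of $\gamma$ some $\alpha_i$ is nonzero, and $$\kappa_2=\sqrt{\sum_{i}\alpha_i^2},\qquad E_3=\frac{\delta}{\sqrt{\sum_i\alpha_i^2}}\sum_{i}\alpha_i\xi_i .$$ If $r\ge4$, then $$\kappa_3=\sqrt{\sum_{i}\Big[\Big(\tfrac{\alpha_i}{\sqrt{\sum_j\alpha_j^2}}\Big)'\Big]^2},\qquad \kappa_3E_4=\delta\sum_{i}\Big(\tfrac{\alpha_i}{\sqrt{\sum_j\alpha_j^2}}\Big)'\xi_i .$$ If $r=3$, there are constants $c_1,\dots,c_s$ with $\sum_ic_i^2=1$ such that $\alpha_i=c_i\sqrt{\sum_j\alpha_j^2}$ along $\gamma$ for all $i$, and $E_3=\delta\sum_ic_i\xi_i$. -/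

import Mathlib

open Bundle Set Manifold
open scoped ContDiff

noncomputable section

namespace TransS

variable {m : ℕ} {M : Type*} [TopologicalSpace M]
  [ChartedSpace (EuclideanSpace ℝ (Fin m)) M] [IsManifold (𝓡 m) ∞ M]

/-- The type of (not necessarily smooth) vector fields on `M`. -/
abbrev VField (m : ℕ) (M : Type*) [TopologicalSpace M]
    [ChartedSpace (EuclideanSpace ℝ (Fin m)) M] :=
  (x : M) → TangentSpace (𝓡 m) x

/-- An affine connection on `M`; `cov Y x v` is `(∇_v Y)(x)`. -/
abbrev Connection (m : ℕ) (M : Type*) [TopologicalSpace M]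
    [ChartedSpace (EuclideanSpace ℝ (Fin m)) M] [IsManifold (𝓡 m) ∞ M] :=
  CovariantDerivative (𝓡 m) (EuclideanSpace ℝ (Fin m)) (TangentSpace (𝓡 m) : M → Type _)

/-- The vector field `X` is smooth near `x`. -/
def SmoothFieldAt (X : VField m M) (x : M) : Prop :=
  ContMDiffAt (𝓡 m) (𝓡 m).tangent ∞ (fun y => (⟨y, X y⟩ : TangentBundle (𝓡 m) M)) x

section Metric

variable [RiemannianBundle (fun x : M => TangentSpace (𝓡 m) x)]
  [IsContMDiffRiemannianBundle (𝓡 m) ∞ (EuclideanSpace ℝ (Fin m))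
    (fun x : M => TangentSpace (𝓡 m) x)]

set_option synthInstance.maxHeartbeats 200000 in
/-- `∇` is the Levi-Civita connection: it is torsion-free and compatible with the metric.
On smooth vector fields these two properties determine it. -/
def IsLeviCivita (cov : Connection m M) : Prop :=
  cov.torsion = 0 ∧ cov.IsMetricCompatible

end Metric

/-- `(∇_v f) Y` at `x`, for a `(1,1)`-tensor field `f`:
`(∇_v f) Y = ∇_v (f Y) - f (∇_v Y)`. -/
def covTensor (cov : Connection m M)
    (f : (x : M) → TangentSpace (𝓡 m) x →L[ℝ] TangentSpace (𝓡 m) x)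
    (Y : VField m M) (x : M) (v : TangentSpace (𝓡 m) x) : TangentSpace (𝓡 m) x :=
  cov (fun y => f y (Y y)) x v - f x (cov Y x v)

/-- The Nijenhuis torsion
`[f, f](X, Y) = f² [X, Y] + [f X, f Y] - f [f X, Y] - f [X, f Y]`. -/
def nijenhuis (f : (x : M) → TangentSpace (𝓡 m) x →L[ℝ] TangentSpace (𝓡 m) x)
    (X Y : VField m M) (x : M) : TangentSpace (𝓡 m) x :=
  f x (f x (VectorField.mlieBracket (𝓡 m) X Y x))
    + VectorField.mlieBracket (𝓡 m) (fun y => f y (X y)) (fun y => f y (Y y)) x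
    - f x (VectorField.mlieBracket (𝓡 m) (fun y => f y (X y)) Y x)
    - f x (VectorField.mlieBracket (𝓡 m) X (fun y => f y (Y y)) x)

/-- `2 dη(X, Y) = X (η Y) - Y (η X) - η [X, Y]` for a one-form `η`
(with the convention `2 dη` that goes with the factor `2` in the normality condition). -/
def twoDEta (η : (x : M) → TangentSpace (𝓡 m) x →L[ℝ] ℝ)
    (X Y : VField m M) (x : M) : ℝ :=
  mvfderiv (𝓡 m) (fun y => η y (Y y)) x (X x)
    - mvfderiv (𝓡 m) (fun y => η y (X y)) x (Y x)
    - η x (VectorField.mlieBracket (𝓡 m) X Y x)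

/-- A framed metric `f`-structure `(f, ξ_i, η_i, g)`, `i = 1, …, s`, on a Riemannian manifold
`(M, g)` of dimension `2 n + s`. (The one-forms `η_i` are metrically dual to the smooth vector
fields `ξ_i`, hence smooth.) -/
structure FramedMetricStructure (n s : ℕ) (M : Type*) [TopologicalSpace M]
    [ChartedSpace (EuclideanSpace ℝ (Fin (2 * n + s))) M] [IsManifold (𝓡 (2 * n + s)) ∞ M]
    [RiemannianBundle (fun x : M => TangentSpace (𝓡 (2 * n + s)) x)] where
  f : (x : M) → TangentSpace (𝓡 (2 * n + s)) x →L[ℝ] TangentSpace (𝓡 (2 * n + s)) x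
  ξ : Fin s → VField (2 * n + s) M
  η : Fin s → (x : M) → TangentSpace (𝓡 (2 * n + s)) x →L[ℝ] ℝ
  f_smooth : ContMDiff (𝓡 (2 * n + s))
    ((𝓡 (2 * n + s)).prod 𝓘(ℝ, EuclideanSpace ℝ (Fin (2 * n + s)) →L[ℝ]
      EuclideanSpace ℝ (Fin (2 * n + s)))) ∞
    (fun x => TotalSpace.mk' (EuclideanSpace ℝ (Fin (2 * n + s)) →L[ℝ]
      EuclideanSpace ℝ (Fin (2 * n + s))) x (f x))
  ξ_smooth : ∀ i x, SmoothFieldAt (ξ i) x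
  f_rank : ∀ x, Module.finrank ℝ (LinearMap.range (f x).toLinearMap) = 2 * n
  f_sq : ∀ x (v : TangentSpace (𝓡 (2 * n + s)) x),
    f x (f x v) = -v + ∑ i, η i x v • ξ i x
  η_ξ : ∀ i j x, η i x (ξ j x) = if i = j then 1 else 0
  f_ξ : ∀ i x, f x (ξ i x) = 0
  η_f : ∀ i x (v : TangentSpace (𝓡 (2 * n + s)) x), η i x (f x v) = 0
  metric_f : ∀ x (v w : TangentSpace (𝓡 (2 * n + s)) x),
    inner ℝ (f x v) (f x w) = inner ℝ v w - ∑ i, η i x v * η i x w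
  η_eq : ∀ i x (v : TangentSpace (𝓡 (2 * n + s)) x), η i x v = inner ℝ v (ξ i x)

/-- The framed metric `f`-structure `S` is a trans-`S`-structure with functions `α_i`, `β_i`
(`cov` is meant to be the Levi-Civita connection):
* the functions `α_i`, `β_i` are smooth;
* `(∇_X f) Y = ∑ i, α_i {g(f X, f Y) ξ_i + η_i(Y) f² X} + β_i {g(f X, Y) ξ_i - η_i(Y) f X}`
  (the almost trans-`S` condition);
* `[f, f] + 2 ∑ i, dη_i ⊗ ξ_i = 0` (normality).
All expressions are local and tensorial in `X` and `Y`, so it is immaterial whether `X` and `Y`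
are smooth everywhere or only near the point of evaluation. -/
structure IsTransS {n s : ℕ} {M : Type*} [TopologicalSpace M]
    [ChartedSpace (EuclideanSpace ℝ (Fin (2 * n + s))) M] [IsManifold (𝓡 (2 * n + s)) ∞ M]
    [RiemannianBundle (fun x : M => TangentSpace (𝓡 (2 * n + s)) x)]
    (cov : Connection (2 * n + s) M) (S : FramedMetricStructure n s M)
    (α β : Fin s → M → ℝ) : Prop where
  α_smooth : ∀ i, ContMDiff (𝓡 (2 * n + s)) 𝓘(ℝ, ℝ) ∞ (α i)
  β_smooth : ∀ i, ContMDiff (𝓡 (2 * n + s)) 𝓘(ℝ, ℝ) ∞ (β i)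
  cov_f : ∀ (x : M) (X Y : VField (2 * n + s) M), SmoothFieldAt X x → SmoothFieldAt Y x →
    covTensor cov S.f Y x (X x) =
      ∑ i, (α i x • ((inner ℝ (S.f x (X x)) (S.f x (Y x)) : ℝ) • S.ξ i x
              + S.η i x (Y x) • S.f x (S.f x (X x)))
          + β i x • ((inner ℝ (S.f x (X x)) (Y x) : ℝ) • S.ξ i x
              - S.η i x (Y x) • S.f x (X x)))
  normal : ∀ (x : M) (X Y : VField (2 * n + s) M), SmoothFieldAt X x → SmoothFieldAt Y x →
    nijenhuis S.f X Y x + ∑ i, twoDEta (S.η i) X Y x • S.ξ i x = 0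

/-! ### Curves, defined on an interval `J ⊆ ℝ` -/

/-- The velocity `γ'(t)` (one-sided at an end point of `J` that belongs to `J`). -/
def velocity (γ : ℝ → M) (J : Set ℝ) (t : ℝ) : TangentSpace (𝓡 m) (γ t) :=
  mfderivWithin 𝓘(ℝ, ℝ) (𝓡 m) γ J t (1 : ℝ)

/-- A vector field along `γ` that is smooth on `J`. -/
def SmoothAlong (γ : ℝ → M) (J : Set ℝ) (V : (t : ℝ) → TangentSpace (𝓡 m) (γ t)) : Prop :=
  ContMDiffOn 𝓘(ℝ, ℝ) (𝓡 m).tangent ∞ (fun t => (⟨γ t, V t⟩ : TangentBundle (𝓡 m) M)) J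

/-- The components, in the coordinate frame of the preferred chart at `p`, of a tangent
vector `v` at a point `x` near `p`. -/
def components (p : M) {x : M} (v : TangentSpace (𝓡 m) x) : EuclideanSpace ℝ (Fin m) :=
  (trivializationAt (EuclideanSpace ℝ (Fin m)) (TangentSpace (𝓡 m) : M → Type _) p
    (⟨x, v⟩ : TangentBundle (𝓡 m) M)).2

/-- The vector field near `p` with constant components `w` in the coordinate frame of the
preferred chart at `p`. -/
def constField (p : M) (w : EuclideanSpace ℝ (Fin m)) : VField m M := fun x =>
  (trivializationAt (EuclideanSpace ℝ (Fin m)) (TangentSpace (𝓡 m) : M → Type _) p).symm x w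

/-- The covariant derivative `∇_T V` of a vector field `V` along `γ`. With `V = ∑ k, V^k ∂_k` in
the coordinate frame `∂_k` of the chart at `γ(t)`, it is
`∑ k, (V^k)'(t) ∂_k + ∑ k, V^k(t) ∇_{γ'(t)} ∂_k`. -/
def covAlong (cov : Connection m M) (γ : ℝ → M) (J : Set ℝ)
    (V : (t : ℝ) → TangentSpace (𝓡 m) (γ t)) (t : ℝ) : TangentSpace (𝓡 m) (γ t) :=
  constField (γ t) (derivWithin (fun τ => components (γ t) (V τ)) J t) (γ t)
    + cov (constField (γ t) (components (γ t) (V t))) (γ t) (velocity γ J t)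

/-- `γ` is a smooth curve on `J` of unit speed. -/
structure IsUnitSpeed [RiemannianBundle (fun x : M => TangentSpace (𝓡 m) x)]
    (γ : ℝ → M) (J : Set ℝ) : Prop where
  smooth : ContMDiffOn 𝓘(ℝ, ℝ) (𝓡 m) ∞ γ J
  unit : ∀ t ∈ J, inner ℝ (velocity γ J t : TangentSpace (𝓡 m) (γ t)) (velocity γ J t) = (1 : ℝ)

/-- The unit-speed curve `γ` is a Frenet curve of osculating order `r` with Frenet frame
`E 1, …, E r` and curvatures `κ 1, …, κ (r - 1)`. (Other values of `E`, `κ` play no role.) -/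
structure IsFrenetCurve [RiemannianBundle (fun x : M => TangentSpace (𝓡 m) x)]
    (cov : Connection m M) (γ : ℝ → M) (J : Set ℝ) (r : ℕ)
    (E : ℕ → (t : ℝ) → TangentSpace (𝓡 m) (γ t)) (κ : ℕ → ℝ → ℝ) : Prop where
  unitSpeed : IsUnitSpeed (m := m) γ J
  one_le : 1 ≤ r
  smooth : ∀ j, 1 ≤ j → j ≤ r → SmoothAlong γ J (E j)
  orthonormal : ∀ i j, 1 ≤ i → i ≤ r → 1 ≤ j → j ≤ r → ∀ t ∈ J,
    (inner ℝ (E i t) (E j t) : ℝ) = if i = j then 1 else 0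
  κ_pos : ∀ j, 1 ≤ j → j < r → ∀ t ∈ J, 0 < κ j t
  tangent : ∀ t ∈ J, E 1 t = velocity γ J t
  frenet : ∀ j, 1 ≤ j → j ≤ r → ∀ t ∈ J,
    covAlong cov γ J (E j) t =
      (if j = 1 then 0 else -(κ (j - 1) t • E (j - 1) t))
        + (if j = r then 0 else κ j t • E (j + 1) t)

/-- A Legendre curve: a unit-speed smooth curve with `η_i(T) = 0` for all `i`. -/
def IsLegendre {n s : ℕ} {M : Type*} [TopologicalSpace M]
    [ChartedSpace (EuclideanSpace ℝ (Fin (2 * n + s))) M] [IsManifold (𝓡 (2 * n + s)) ∞ M]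
    [RiemannianBundle (fun x : M => TangentSpace (𝓡 (2 * n + s)) x)]
    (S : FramedMetricStructure n s M) (γ : ℝ → M) (J : Set ℝ) : Prop :=
  IsUnitSpeed (m := 2 * n + s) γ J ∧ ∀ i, ∀ t ∈ J, S.η i (γ t) (velocity γ J t) = 0

/-- A trajectory of strength `q`: `∇_T T = -q f T`. -/
def IsTrajectory {n s : ℕ} {M : Type*} [TopologicalSpace M]
    [ChartedSpace (EuclideanSpace ℝ (Fin (2 * n + s))) M] [IsManifold (𝓡 (2 * n + s)) ∞ M]
    [RiemannianBundle (fun x : M => TangentSpace (𝓡 (2 * n + s)) x)]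
    (cov : Connection (2 * n + s) M) (S : FramedMetricStructure n s M) (q : ℝ)
    (γ : ℝ → M) (J : Set ℝ) : Prop :=
  ∀ t ∈ J, covAlong cov γ J (velocity γ J) t = -q • S.f (γ t) (velocity γ J t)

/-- `√(∑ i, α_i²)` along `γ`. -/
def normα {s : ℕ} {M : Type*} (α : Fin s → M → ℝ) (γ : ℝ → M) (t : ℝ) : ℝ :=
  √(∑ i, α i (γ t) ^ 2)

/-- The derivative, along `γ`, of `α_i / √(∑ j, α_j²)`. -/
def derivRatio {s : ℕ} {M : Type*} (α : Fin s → M → ℝ) (γ : ℝ → M) (J : Set ℝ) (i : Fin s)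
    (t : ℝ) : ℝ :=
  derivWithin (fun τ => α i (γ τ) / normα α γ τ) J t

end TransS

end

/-! Everything follows from one formula: for horizontal `v` (all `η_i v = 0`), `∇_v ξ_j = β_j v -
α_j f v`. Putting `Y = ξ_j` in the trans-`S` condition gives `f (∇_v ξ_j)`, hence `∇_v ξ_j` up to a
combination of the `ξ_k`. That vertical part vanishes by normality, which forces `dη_k(X, ξ_j) = 0`
(`IsTransS.twoDEta_ξ`, `IsTransS.cov_ξ_of_horizontal`).

Differentiating `g(T, ξ_i) = 0` along the curve then leaves `β_i = 0` (`IsTrajectory.β_eq_zero`).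
Since `fT` is a unit vector orthogonal to `T`, the trans-`S` condition also gives `∇_T(fT) = qT + ∑
α_i ξ_i` (`IsTrajectory.covAlong_f_velocity`).

The classification compares these derivatives with the Frenet equations. Equation 1 gives `κ_1 =
|q|` and `E_2 = δ fT`; equation 2 gives `κ_2 E_3 = δ ∑ α_i ξ_i`, or `0` on the right if `r = 2`;
equation 3 gives `κ_3 E_4 = δ ∑ (α_i/|α|)' ξ_i`, or `0` if `r = 3`. The rest is orthonormality of
the `ξ_i` and positivity of the curvatures. `covAlong_sum_smul` transfers the tensor identities on
`M` to fields along the curve. -/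

noncomputable section

namespace TransS

open scoped Topology

/-! ### Coordinate fields and a connection in components. -/

section Coordinates

variable {m : ℕ} {M : Type*} [TopologicalSpace M]
  [ChartedSpace (EuclideanSpace ℝ (Fin m)) M] [IsManifold (𝓡 m) ∞ M]

/-- The preferred trivialization of the tangent bundle near `p`. -/
abbrev triv (m : ℕ) {M : Type*} [TopologicalSpace M]
    [ChartedSpace (EuclideanSpace ℝ (Fin m)) M] [IsManifold (𝓡 m) ∞ M] (p : M) :=
  trivializationAt (EuclideanSpace ℝ (Fin m)) (TangentSpace (𝓡 m) : M → Type _) p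

lemma mem_triv_baseSet (p : M) : p ∈ (triv m p).baseSet :=
  FiberBundle.mem_baseSet_trivializationAt' p

lemma triv_baseSet_mem_nhds (p : M) : (triv m p).baseSet ∈ 𝓝 p :=
  (triv m p).open_baseSet.mem_nhds (mem_triv_baseSet p)

lemma constField_eq_symmL (p : M) {x : M} (hx : x ∈ (triv m p).baseSet)
    (w : EuclideanSpace ℝ (Fin m)) : constField p w x = (triv m p).symmL ℝ x w := by
  rw [Trivialization.symmL_apply _ hx]; rfl

lemma components_eq (p : M) {x : M} (hx : x ∈ (triv m p).baseSet) (v : TangentSpace (𝓡 m) x) :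
    components p v = (triv m p).continuousLinearMapAt ℝ x v := by
  rw [Trivialization.continuousLinearMapAt_apply, Trivialization.coe_linearMapAt_of_mem _ hx]
  rfl

lemma constField_components (p : M) {x : M} (hx : x ∈ (triv m p).baseSet)
    (v : TangentSpace (𝓡 m) x) : constField p (components p v) x = v := by
  rw [constField_eq_symmL p hx, components_eq p hx, Trivialization.symmL_continuousLinearMapAt _ hx]

lemma components_sum_smul (p : M) {x : M} (hx : x ∈ (triv m p).baseSet) {ι : Type*} (s : Finset ι)
    (a : ι → ℝ) (v : ι → TangentSpace (𝓡 m) x) :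
    components p (∑ i ∈ s, a i • v i) = ∑ i ∈ s, a i • components p (v i) := by
  simp only [components_eq p hx, map_sum, map_smul]

/-- The `k`-th coordinate field of the preferred chart at `p`. -/
def coordField (p : M) (k : Fin m) : VField m M := constField p (EuclideanSpace.single k 1)

lemma constField_eq_sum (p : M) {x : M} (hx : x ∈ (triv m p).baseSet)
    (w : EuclideanSpace ℝ (Fin m)) :
    constField p w x = ∑ k, w k • coordField p k x := by
  simp only [coordField, constField_eq_symmL p hx]
  simp_rw [← map_smul, ← map_sum]
  congr 1
  simpa using ((EuclideanSpace.basisFun (Fin m) ℝ).sum_repr w).symm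

lemma eq_sum_components (p : M) {x : M} (hx : x ∈ (triv m p).baseSet) (v : TangentSpace (𝓡 m) x) :
    v = ∑ k, components p v k • coordField p k x := by
  rw [← constField_eq_sum p hx, constField_components p hx]

lemma smoothFieldAt_constField (p : M) (w : EuclideanSpace ℝ (Fin m)) {x : M}
    (hx : x ∈ (triv m p).baseSet) : SmoothFieldAt (constField p w) x := by
  unfold SmoothFieldAt
  refine (Trivialization.contMDiffAt_section_iff (IB := 𝓡 m) (triv m p) hx).2 ?_
  refine (contMDiffAt_const (c := w)).congr_of_eventuallyEq ?_
  filter_upwards [(triv m p).open_baseSet.mem_nhds hx] with y hy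
  have := Trivialization.apply_mk_symm (triv m p) hy w
  exact congrArg Prod.snd this

/-- `Y` is differentiable at `x` as a section of the tangent bundle. -/
abbrev DiffFieldAt (Y : VField m M) (x : M) : Prop :=
  MDifferentiableAt (𝓡 m) (𝓡 m).tangent (fun y => (⟨y, Y y⟩ : TangentBundle (𝓡 m) M)) x

lemma SmoothFieldAt.diffFieldAt {Y : VField m M} {x : M} (h : SmoothFieldAt Y x) :
    DiffFieldAt Y x :=
  ContMDiffAt.mdifferentiableAt h (by simp)

lemma diffFieldAt_coordField (p : M) (k : Fin m) : DiffFieldAt (coordField p k) p :=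
  (smoothFieldAt_constField p _ (mem_triv_baseSet p)).diffFieldAt

lemma mdifferentiableAt_components {Y : VField m M} {p : M} (h : DiffFieldAt Y p) :
    MDifferentiableAt (𝓡 m) 𝓘(ℝ, EuclideanSpace ℝ (Fin m)) (fun y => components p (Y y)) p :=
  ((mdifferentiableAt_totalSpace _ _).1 h).2

lemma DiffFieldAt.smul {g : M → ℝ} {Y : VField m M} {p : M}
    (hg : MDifferentiableAt (𝓡 m) 𝓘(ℝ, ℝ) g p) (hY : DiffFieldAt Y p) :
    DiffFieldAt (g • Y) p :=
  MDifferentiableAt.smul_section hg hY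

lemma DiffFieldAt.sum {ι : Type*} {s : Finset ι} {Y : ι → VField m M} {p : M}
    (hY : ∀ i ∈ s, DiffFieldAt (Y i) p) : DiffFieldAt (∑ i ∈ s, Y i) p := by
  have := MDifferentiableAt.sum_section hY
  unfold DiffFieldAt
  convert this using 3
  simp

lemma cov_sum (cov : Connection m M) {ι : Type*} (s : Finset ι) (Y : ι → VField m M) {p : M}
    (hY : ∀ i ∈ s, DiffFieldAt (Y i) p) (v : TangentSpace (𝓡 m) p) :
    cov (∑ i ∈ s, Y i) p v = ∑ i ∈ s, cov (Y i) p v := by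
  classical
  induction s using Finset.induction_on with
  | empty => simp
  | insert a s ha ih =>
    rw [Finset.sum_insert ha, Finset.sum_insert ha,
      cov.isCovariantDerivativeOnUniv.add (hY a (by simp))
        (DiffFieldAt.sum fun i hi => hY i (by simp [hi])), ← ih fun i hi => hY i (by simp [hi])]
    rfl

lemma cov_smul (cov : Connection m M) {g : M → ℝ} {Y : VField m M} {p : M}
    (hg : MDifferentiableAt (𝓡 m) 𝓘(ℝ, ℝ) g p) (hY : DiffFieldAt Y p)
    (v : TangentSpace (𝓡 m) p) :
    cov (g • Y) p v = g p • cov Y p v + mvfderiv (𝓡 m) g p v • Y p := by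
  rw [cov.isCovariantDerivativeOnUniv.leibniz hY hg]
  rfl

lemma cov_congr (cov : Connection m M) {Y Y' : VField m M} {p : M} (hY : DiffFieldAt Y p)
    (hY' : DiffFieldAt Y' p) (h : ∀ᶠ x in 𝓝 p, Y x = Y' x) : cov Y p = cov Y' p :=
  cov.isCovariantDerivativeOnUniv.congr_of_eventuallyEq hY hY' Filter.univ_mem h

/-- Makes the second term of `covAlong` visibly linear in the components. The expansion in
coordinate fields holds only on the trivialization domain, so locality of the connection is needed.
-/
lemma cov_constField (cov : Connection m M) (p : M) (w : EuclideanSpace ℝ (Fin m))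
    (v : TangentSpace (𝓡 m) p) :
    cov (constField p w) p v = ∑ k, w k • cov (coordField p k) p v := by
  have hd : ∀ k, DiffFieldAt ((fun _ : M => w k) • coordField p k) p := fun k =>
    DiffFieldAt.smul mdifferentiableAt_const (diffFieldAt_coordField p k)
  rw [cov_congr cov (Y' := ∑ k, (fun _ : M => w k) • coordField p k)
      (smoothFieldAt_constField p w (mem_triv_baseSet p)).diffFieldAt
      (DiffFieldAt.sum fun k _ => hd k), cov_sum _ _ _ fun k _ => hd k]
  · refine Finset.sum_congr rfl fun k _ => ?_
    rw [cov_smul _ mdifferentiableAt_const (diffFieldAt_coordField p k), mvfderiv_const]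
    simp
  · filter_upwards [triv_baseSet_mem_nhds (m := m) p] with x hx
    simp [constField_eq_sum p hx]

lemma mdifferentiableAt_apply {N : Type*} [TopologicalSpace N] {E H : Type*}
    [NormedAddCommGroup E] [NormedSpace ℝ E] [TopologicalSpace H] {I : ModelWithCorners ℝ E H}
    [ChartedSpace H N] {c : N → EuclideanSpace ℝ (Fin m)} {p : N}
    (h : MDifferentiableAt I 𝓘(ℝ, EuclideanSpace ℝ (Fin m)) c p) (k : Fin m) :
    MDifferentiableAt I 𝓘(ℝ, ℝ) (fun x => c x k) p ∧
      ∀ v, mvfderiv I (fun x => c x k) p v = mvfderiv I c p v k := by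
  have hk := ((EuclideanSpace.proj k : EuclideanSpace ℝ (Fin m) →L[ℝ] ℝ)).hasFDerivAt (x := c p)
  have := HasMFDerivAt.comp p hk.hasMFDerivAt h.hasMFDerivAt
  refine ⟨this.mdifferentiableAt, fun v => ?_⟩
  have h2 := this.mfderiv
  unfold mvfderiv
  erw [h2]
  rfl

/-- The analogue on `M` of the formula defining `covAlong`; comparing the two shows that `covAlong`
of a restricted field is `cov` in the direction of the velocity. -/
lemma cov_eq_components (cov : Connection m M) {Y : VField m M} {p : M} (hY : DiffFieldAt Y p)
    (v : TangentSpace (𝓡 m) p) :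
    cov Y p v = constField p (mvfderiv (𝓡 m) (fun x => components p (Y x)) p v) p
      + cov (constField p (components p (Y p))) p v := by
  have hc := mdifferentiableAt_components hY
  have hd : ∀ k, DiffFieldAt ((fun x => components p (Y x) k) • coordField p k) p := fun k =>
    DiffFieldAt.smul (mdifferentiableAt_apply hc k).1 (diffFieldAt_coordField p k)
  rw [cov_congr cov (Y' := ∑ k, (fun x => components p (Y x) k) • coordField p k) hY
      (DiffFieldAt.sum fun k _ => hd k), cov_sum _ _ _ fun k _ => hd k, cov_constField,
      constField_eq_sum p (mem_triv_baseSet p), ← Finset.sum_add_distrib]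
  · refine Finset.sum_congr rfl fun k _ => ?_
    rw [cov_smul _ (mdifferentiableAt_apply hc k).1 (diffFieldAt_coordField p k),
      (mdifferentiableAt_apply hc k).2, add_comm]
  · filter_upwards [triv_baseSet_mem_nhds (m := m) p] with x hx
    simpa using eq_sum_components p hx (Y x)

end Coordinates

/-! ### Calculus of vector fields along a curve. -/

section AlongCurve

variable {m : ℕ} {M : Type*} [TopologicalSpace M]
  [ChartedSpace (EuclideanSpace ℝ (Fin m)) M] [IsManifold (𝓡 m) ∞ M]

omit [IsManifold (𝓡 m) ∞ M] in
lemma hasDerivWithinAt_comp {F : Type*} [NormedAddCommGroup F] [NormedSpace ℝ F] {γ : ℝ → M}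
    {J : Set ℝ} {t : ℝ} {g : M → F} (hg : MDifferentiableAt (𝓡 m) 𝓘(ℝ, F) g (γ t))
    (hγ : MDifferentiableWithinAt 𝓘(ℝ, ℝ) (𝓡 m) γ J t) :
    HasDerivWithinAt (fun τ => g (γ τ)) (mvfderiv (𝓡 m) g (γ t) (velocity γ J t)) J t := by
  have h := hg.hasMFDerivAt.comp_hasMFDerivWithinAt t hγ.hasMFDerivWithinAt
  have h' : HasFDerivWithinAt (fun τ => g (γ τ))
      ((mvfderiv (𝓡 m) g (γ t)).comp (mfderivWithin 𝓘(ℝ, ℝ) (𝓡 m) γ J t) : ℝ →L[ℝ] F) J t :=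
    hasMFDerivWithinAt_iff_hasFDerivWithinAt.1 h
  exact h'.hasDerivWithinAt

/-- `∇_T (∑ i, φ_i Y_i) = ∑ i, (φ_i' Y_i + φ_i ∇_T Y_i)` for vector fields `Y_i` on `M`. -/
lemma covAlong_sum_smul (cov : Connection m M) {γ : ℝ → M} {J : Set ℝ} {t : ℝ} (ht : t ∈ J)
    (hJ : UniqueDiffWithinAt ℝ J t) (hγ : MDifferentiableWithinAt 𝓘(ℝ, ℝ) (𝓡 m) γ J t)
    {V : (t : ℝ) → TangentSpace (𝓡 m) (γ t)} {ι : Type*} [Fintype ι] {φ : ι → ℝ → ℝ} {φ' : ι → ℝ}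
    {Y : ι → VField m M} (hφ : ∀ i, HasDerivWithinAt (φ i) (φ' i) J t)
    (hY : ∀ i, DiffFieldAt (Y i) (γ t))
    (hV : ∀ᶠ τ in 𝓝[J] t, V τ = ∑ i, φ i τ • Y i (γ τ)) :
    covAlong cov γ J V t =
      ∑ i, (φ' i • Y i (γ t) + φ i t • cov (Y i) (γ t) (velocity γ J t)) := by
  have hp := mem_triv_baseSet (m := m) (γ t)
  have hVt : V t = ∑ i, φ i t • Y i (γ t) := hV.self_of_nhdsWithin ht
  -- Components are linear only while the curve stays in the trivialization domain at `γ t`, hence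
  -- only for `τ` near `t`.
  have hev : (fun τ => components (γ t) (V τ)) =ᶠ[𝓝[J] t]
      fun τ => ∑ i, φ i τ • components (γ t) (Y i (γ τ)) := by
    filter_upwards [hV, hγ.continuousWithinAt.preimage_mem_nhdsWithin
      (triv_baseSet_mem_nhds (m := m) (γ t))] with τ h1 h2
    rw [h1, components_sum_smul (γ t) h2]
  have hder : HasDerivWithinAt (fun τ => components (γ t) (V τ))
      (∑ i, (φ i t • mvfderiv (𝓡 m) (fun x => components (γ t) (Y i x)) (γ t) (velocity γ J t)
        + φ' i • components (γ t) (Y i (γ t)))) J t := by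
    refine HasDerivWithinAt.congr_of_eventuallyEq ?_ hev (hev.self_of_nhdsWithin ht)
    exact HasDerivWithinAt.fun_sum fun i _ => (hφ i).smul
      (hasDerivWithinAt_comp (mdifferentiableAt_components (hY i)) hγ)
  have hY' : ∀ i, Y i (γ t) = (triv m (γ t)).symmL ℝ (γ t) (components (γ t) (Y i (γ t))) :=
    fun i => by rw [← constField_eq_symmL _ hp, constField_components _ hp]
  have hcov : cov (constField (γ t) (∑ i, φ i t • components (γ t) (Y i (γ t)))) (γ t)
      (velocity γ J t) = ∑ i, φ i t • cov (constField (γ t) (components (γ t) (Y i (γ t)))) (γ t)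
        (velocity γ J t) := by
    simp only [cov_constField, WithLp.ofLp_sum, Finset.sum_apply, PiLp.smul_apply, Finset.sum_smul,
      Finset.smul_sum, smul_smul, smul_eq_mul]
    rw [Finset.sum_comm]
  unfold covAlong
  rw [hder.derivWithin hJ, hVt, components_sum_smul (γ t) hp, hcov, constField_eq_symmL _ hp,
    map_sum, ← Finset.sum_add_distrib]
  refine Finset.sum_congr rfl fun i _ => ?_
  rw [map_add, map_smul, map_smul, ← hY', cov_eq_components cov (hY i), constField_eq_symmL _ hp,
    smul_add]
  abel

lemma SmoothAlong.differentiableWithinAt_components {γ : ℝ → M} {J : Set ℝ}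
    {V : (t : ℝ) → TangentSpace (𝓡 m) (γ t)} (hV : SmoothAlong γ J V) {t : ℝ} (ht : t ∈ J) :
    DifferentiableWithinAt ℝ (fun τ => components (γ t) (V τ)) J t :=
  ((contMDiffWithinAt_totalSpace.1 (hV t ht)).2.contDiffWithinAt).differentiableWithinAt (by simp)

lemma SmoothAlong.contMDiffOn {γ : ℝ → M} {J : Set ℝ}
    {V : (t : ℝ) → TangentSpace (𝓡 m) (γ t)} (hV : SmoothAlong γ J V) :
    ContMDiffOn 𝓘(ℝ, ℝ) (𝓡 m) ∞ γ J :=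
  fun t ht => (contMDiffWithinAt_totalSpace.1 (hV t ht)).1

/-- A smooth field along a curve is locally a combination of coordinate fields. -/
lemma SmoothAlong.exists_expansion {γ : ℝ → M} {J : Set ℝ}
    {V : (t : ℝ) → TangentSpace (𝓡 m) (γ t)} (hV : SmoothAlong γ J V) {t : ℝ} (ht : t ∈ J) :
    ∃ (φ : Fin m → ℝ → ℝ) (φ' : Fin m → ℝ), (∀ k, HasDerivWithinAt (φ k) (φ' k) J t) ∧
      ∀ᶠ τ in 𝓝[J] t, V τ = ∑ k, φ k τ • coordField (γ t) k (γ τ) := by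
  refine ⟨fun k τ => components (γ t) (V τ) k,
    fun k => derivWithin (fun τ => components (γ t) (V τ)) J t k, fun k => ?_, ?_⟩
  · exact ((EuclideanSpace.proj k : EuclideanSpace ℝ (Fin m) →L[ℝ] ℝ).hasFDerivAt
      ).comp_hasDerivWithinAt t (hV.differentiableWithinAt_components ht).hasDerivWithinAt
  · filter_upwards [(hV.contMDiffOn t ht).continuousWithinAt.preimage_mem_nhdsWithin
      (triv_baseSet_mem_nhds (m := m) (γ t))] with τ hτ
    exact eq_sum_components (γ t) hτ (V τ)

lemma covAlong_congr (cov : Connection m M) {γ : ℝ → M} {J : Set ℝ}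
    {V W : (t : ℝ) → TangentSpace (𝓡 m) (γ t)} (h : ∀ t ∈ J, V t = W t) {t : ℝ} (ht : t ∈ J) :
    covAlong cov γ J V t = covAlong cov γ J W t := by
  unfold covAlong
  rw [h t ht, derivWithin_congr (fun τ hτ => by rw [h τ hτ]) (by rw [h t ht])]

lemma covAlong_const_smul (cov : Connection m M) {γ : ℝ → M} {J : Set ℝ} {t : ℝ} (ht : t ∈ J)
    (hJ : UniqueDiffWithinAt ℝ J t) {V : (t : ℝ) → TangentSpace (𝓡 m) (γ t)}
    (hV : SmoothAlong γ J V) (c : ℝ) :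
    covAlong cov γ J (fun τ => c • V τ) t = c • covAlong cov γ J V t := by
  obtain ⟨φ, φ', hφ, hexp⟩ := hV.exists_expansion ht
  have hγ := (hV.contMDiffOn t ht).mdifferentiableWithinAt (by simp)
  rw [covAlong_sum_smul cov ht hJ hγ hφ (fun k => diffFieldAt_coordField _ k) hexp,
    covAlong_sum_smul cov ht hJ hγ (fun k => (hφ k).const_mul c)
      (fun k => diffFieldAt_coordField _ k)]
  · simp only [Finset.smul_sum, smul_add, smul_smul]
  · filter_upwards [hexp] with τ hτ
    simp only [hτ, Finset.smul_sum, smul_smul]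

lemma SmoothAlong.const_smul {γ : ℝ → M} {J : Set ℝ}
    {V : (t : ℝ) → TangentSpace (𝓡 m) (γ t)} (hV : SmoothAlong γ J V) (c : ℝ) :
    SmoothAlong γ J (fun t => c • V t) := by
  intro t ht
  have h := contMDiffWithinAt_totalSpace.1 (hV t ht)
  refine contMDiffWithinAt_totalSpace.2 ⟨h.1, ?_⟩
  have h2 := h.2.contDiffWithinAt.const_smul c
  refine h2.contMDiffWithinAt.congr_of_eventuallyEq_of_mem ?_ ht
  filter_upwards [h.1.continuousWithinAt.preimage_mem_nhdsWithin
    (triv_baseSet_mem_nhds (m := m) (γ t))] with τ hτ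
  exact (((triv m (γ t)).linear ℝ hτ).map_smul c (V τ))

/-- A convex set with an interior point, here a midpoint, has unique derivatives, also one-sided
ones at its end points. -/
lemma uniqueDiffOn_of_ordConnected {J : Set ℝ} (hJ : J.OrdConnected) (hJ' : J.Nontrivial) :
    UniqueDiffOn ℝ J := by
  obtain ⟨a, ha, b, hb, hab⟩ := hJ'.exists_lt
  refine uniqueDiffOn_convex hJ.convex ⟨(a + b) / 2, ?_⟩
  exact interior_mono (Ioo_subset_Icc_self.trans (hJ.out ha hb))
    (by rw [interior_Ioo]; constructor <;> linarith)

/-- The velocity is the tangent map of the curve composed with the constant unit section of the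
tangent bundle of `ℝ`. -/
lemma smoothAlong_velocity {γ : ℝ → M} {J : Set ℝ} (hJ : UniqueDiffOn ℝ J)
    (hγ : ContMDiffOn 𝓘(ℝ, ℝ) (𝓡 m) ∞ γ J) : SmoothAlong γ J (velocity (m := m) γ J) := by
  have h1 : ContMDiff 𝓘(ℝ, ℝ) 𝓘(ℝ, ℝ).tangent ∞
      (fun t : ℝ => (⟨t, (1 : ℝ)⟩ : TangentBundle 𝓘(ℝ, ℝ) ℝ)) :=
    contMDiff_vectorSpace_iff_contDiff.2 contDiff_const
  have h2 := hγ.contMDiffOn_tangentMapWithin (m := ∞) (by simp) hJ.uniqueMDiffOn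
  exact h2.comp h1.contMDiffOn fun t ht => ht

end AlongCurve

/-! ### Algebra of the framed structure and the derivatives of the `ξ_j`. -/

section Structure

variable {n s : ℕ} {M : Type*} [TopologicalSpace M]
  [ChartedSpace (EuclideanSpace ℝ (Fin (2 * n + s))) M] [IsManifold (𝓡 (2 * n + s)) ∞ M]
  [RiemannianBundle (fun x : M => TangentSpace (𝓡 (2 * n + s)) x)]

namespace FramedMetricStructure

variable (S : FramedMetricStructure n s M)

lemma inner_ξ_ξ (i j : Fin s) (x : M) :
    (inner ℝ (S.ξ i x) (S.ξ j x) : ℝ) = if i = j then 1 else 0 := by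
  rw [← S.η_eq, S.η_ξ]
  simp only [eq_comm]

lemma inner_f_ξ (i : Fin s) {x : M} (v : TangentSpace (𝓡 (2 * n + s)) x) :
    (inner ℝ (S.f x v) (S.ξ i x) : ℝ) = 0 := by
  rw [← S.η_eq, S.η_f]

/-- Compatibility of the metric for the pair `v`, `f w`: there `f (f w)` is `-w` plus a vertical
vector, which is orthogonal to `f v`. -/
lemma inner_f_left {x : M} (v w : TangentSpace (𝓡 (2 * n + s)) x) :
    (inner ℝ (S.f x v) w : ℝ) = -inner ℝ v (S.f x w) := by
  have h := S.metric_f x v (S.f x w)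
  rw [S.f_sq, inner_add_right, inner_neg_right, inner_sum] at h
  simp only [inner_smul_right, inner_f_ξ, S.η_f, mul_zero, Finset.sum_const_zero, add_zero,
    sub_zero] at h
  linarith

lemma inner_f_self {x : M} (v : TangentSpace (𝓡 (2 * n + s)) x) :
    (inner ℝ (S.f x v) v : ℝ) = 0 := by
  have h := S.inner_f_left v v
  rw [real_inner_comm] at h ⊢
  linarith

lemma f_sq_of_horizontal {x : M} {v : TangentSpace (𝓡 (2 * n + s)) x} (hv : ∀ i, S.η i x v = 0) :
    S.f x (S.f x v) = -v := by
  simp [S.f_sq, hv]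

lemma inner_sum_ξ (a b : Fin s → ℝ) (x : M) :
    (inner ℝ (∑ i, a i • S.ξ i x) (∑ i, b i • S.ξ i x) : ℝ) = ∑ i, a i * b i := by
  simp [sum_inner, inner_sum, inner_smul_left, inner_smul_right, inner_ξ_ξ, mul_comm]

lemma η_sum_ξ (a : Fin s → ℝ) (k : Fin s) (x : M) : S.η k x (∑ i, a i • S.ξ i x) = a k := by
  simp [map_sum, S.η_ξ]

lemma sum_ξ_eq_zero_iff {a : Fin s → ℝ} {x : M} : ∑ i, a i • S.ξ i x = 0 ↔ ∀ i, a i = 0 := by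
  refine ⟨fun h i => ?_, fun h => by simp [h]⟩
  rw [← S.η_sum_ξ a i x, h, map_zero]

lemma smoothFieldAt_f {Y : VField (2 * n + s) M} {x : M} (hY : SmoothFieldAt Y x) :
    SmoothFieldAt (fun y => S.f y (Y y)) x :=
  (S.f_smooth x).clm_bundle_apply hY

lemma smoothAlong_f {γ : ℝ → M} {J : Set ℝ} {V : (t : ℝ) → TangentSpace (𝓡 (2 * n + s)) (γ t)}
    (hV : SmoothAlong γ J V) : SmoothAlong γ J (fun t => S.f (γ t) (V t)) :=
  ContMDiffOn.clm_bundle_apply (S.f_smooth.comp_contMDiffOn hV.contMDiffOn) hV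

end FramedMetricStructure

/-- The right-hand side of the trans-`S` condition, as a linear map in `Y`. -/
def transTensor (S : FramedMetricStructure n s M) (α β : Fin s → M → ℝ) (x : M)
    (v : TangentSpace (𝓡 (2 * n + s)) x) :
    TangentSpace (𝓡 (2 * n + s)) x →ₗ[ℝ] TangentSpace (𝓡 (2 * n + s)) x where
  toFun w := ∑ i, (α i x • ((inner ℝ (S.f x v) (S.f x w) : ℝ) • S.ξ i x
        + S.η i x w • S.f x (S.f x v))
      + β i x • ((inner ℝ (S.f x v) w : ℝ) • S.ξ i x - S.η i x w • S.f x v))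
  map_add' w w' := by
    rw [← Finset.sum_add_distrib]
    refine Finset.sum_congr rfl fun i _ => ?_
    simp only [map_add, inner_add_right]
    module
  map_smul' c w := by
    rw [Finset.smul_sum]
    refine Finset.sum_congr rfl fun i _ => ?_
    simp only [map_smul, inner_smul_right, smul_eq_mul, RingHom.id_apply]
    module

lemma transTensor_apply (S : FramedMetricStructure n s M) (α β : Fin s → M → ℝ) {x : M}
    (v w : TangentSpace (𝓡 (2 * n + s)) x) :
    transTensor S α β x v w = ∑ i, (α i x • ((inner ℝ (S.f x v) (S.f x w) : ℝ) • S.ξ i x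
        + S.η i x w • S.f x (S.f x v))
      + β i x • ((inner ℝ (S.f x v) w : ℝ) • S.ξ i x - S.η i x w • S.f x v)) := rfl

namespace IsTransS

variable {cov : Connection (2 * n + s) M} {S : FramedMetricStructure n s M} {α β : Fin s → M → ℝ}

/-- Frees the trans-`S` condition from the field `X`: a single vector `v` is extended by constant
components. -/
lemma cov_f_field (hS : IsTransS cov S α β) {x : M} {Y : VField (2 * n + s) M}
    (hY : SmoothFieldAt Y x) (v : TangentSpace (𝓡 (2 * n + s)) x) :
    cov (fun y => S.f y (Y y)) x v = S.f x (cov Y x v) + transTensor S α β x v (Y x) := by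
  have hx := mem_triv_baseSet (m := 2 * n + s) x
  have h := hS.cov_f x (constField x (components x v)) Y (smoothFieldAt_constField x _ hx) hY
  rw [constField_components x hx] at h
  rw [transTensor_apply, ← h, covTensor]
  abel

/-- Comes from differentiating `f ξ_j = 0`; it determines `∇_v ξ_j` up to a vertical vector. -/
lemma f_cov_ξ (hS : IsTransS cov S α β) (j : Fin s) {x : M}
    (v : TangentSpace (𝓡 (2 * n + s)) x) :
    S.f x (cov (S.ξ j) x v) = β j x • S.f x v - α j x • S.f x (S.f x v) := by
  have h := hS.cov_f_field (S.ξ_smooth j x) v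
  have h0 : (fun y => S.f y (S.ξ j y)) = (0 : VField (2 * n + s) M) := by
    funext y; exact S.f_ξ j y
  rw [h0, CovariantDerivative.zero, transTensor_apply] at h
  simp only [S.f_ξ, inner_zero_right, S.inner_f_ξ, S.η_ξ, zero_smul, zero_add, zero_sub,
    ite_smul, one_smul, smul_ite, smul_zero, smul_neg,
    Finset.sum_add_distrib, Finset.sum_ite_eq', Finset.sum_neg_distrib, Finset.mem_univ,
    if_true] at h
  have h' : (0 : TangentSpace (𝓡 (2 * n + s)) x) = S.f x (cov (S.ξ j) x v) +
      (α j x • S.f x (S.f x v) + -(β j x • S.f x v)) := h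
  rw [eq_comm, add_eq_zero_iff_eq_neg] at h'
  rw [h']
  abel

/-- Apply `η_k` to the normality condition: since `f ξ_j = 0`, the Nijenhuis term is a sum of values
of `f` and a zero bracket, all killed by `η_k`. -/
lemma twoDEta_ξ (hS : IsTransS cov S α β) (j k : Fin s) {x : M} {X : VField (2 * n + s) M}
    (hX : SmoothFieldAt X x) : twoDEta (S.η k) X (S.ξ j) x = 0 := by
  have h := congrArg (S.η k x) (hS.normal x X (S.ξ j) hX (S.ξ_smooth j x))
  have h0 : (fun y => S.f y (S.ξ j y)) = (0 : VField (2 * n + s) M) := by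
    funext y; exact S.f_ξ j y
  rw [map_add, S.η_sum_ξ, nijenhuis, map_sub, map_sub, map_add, S.η_f, S.η_f, S.η_f, h0,
    VectorField.mlieBracket_zero_right] at h
  simpa using h

end IsTransS

set_option synthInstance.maxHeartbeats 200000 in
lemma IsLeviCivita.mvfderiv_inner {m : ℕ} {M : Type*} [TopologicalSpace M]
    [ChartedSpace (EuclideanSpace ℝ (Fin m)) M] [IsManifold (𝓡 m) ∞ M]
    [RiemannianBundle (fun x : M => TangentSpace (𝓡 m) x)]
    [IsContMDiffRiemannianBundle (𝓡 m) ∞ (EuclideanSpace ℝ (Fin m))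
      (fun x : M => TangentSpace (𝓡 m) x)] {cov : Connection m M} (hcov : IsLeviCivita cov)
    {Y Z : VField m M} {x : M} (hY : DiffFieldAt Y x) (hZ : DiffFieldAt Z x)
    (v : TangentSpace (𝓡 m) x) :
    mvfderiv (𝓡 m) (fun y => (inner ℝ (Y y) (Z y) : ℝ)) x v =
      inner ℝ (cov Y x v) (Z x) + inner ℝ (Y x) (cov Z x v) := by
  have hx := mem_triv_baseSet (m := m) x
  have := hcov.2.mvfderiv_inner_eq (constField x (components x v)) hY hZ
  simpa only [constField_components x hx] using this

set_option synthInstance.maxHeartbeats 200000 in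
lemma IsLeviCivita.mlieBracket_eq {m : ℕ} {M : Type*} [TopologicalSpace M]
    [ChartedSpace (EuclideanSpace ℝ (Fin m)) M] [IsManifold (𝓡 m) ∞ M]
    [RiemannianBundle (fun x : M => TangentSpace (𝓡 m) x)]
    [IsContMDiffRiemannianBundle (𝓡 m) ∞ (EuclideanSpace ℝ (Fin m))
      (fun x : M => TangentSpace (𝓡 m) x)] {cov : Connection m M} (hcov : IsLeviCivita cov)
    {X Y : VField m M} {x : M} (hX : DiffFieldAt X x) (hY : DiffFieldAt Y x) :
    VectorField.mlieBracket (𝓡 m) X Y x = cov Y x (X x) - cov X x (Y x) :=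
  ((CovariantDerivative.torsion_eq_zero_iff cov).1 hcov.1 hX hY).symm

namespace IsTransS

variable [IsContMDiffRiemannianBundle (𝓡 (2 * n + s)) ∞ (EuclideanSpace ℝ (Fin (2 * n + s)))
  (fun x : M => TangentSpace (𝓡 (2 * n + s)) x)]
  {cov : Connection (2 * n + s) M} {S : FramedMetricStructure n s M} {α β : Fin s → M → ℝ}

/-- This is `dη_k(X, ξ_j) = 0` rewritten with the metric, torsion-free connection; the terms
containing `∇_{ξ_j} X` cancel. -/
lemma inner_cov_ξ_ξ (hcov : IsLeviCivita cov) (hS : IsTransS cov S α β) (j k : Fin s) {x : M}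
    (v : TangentSpace (𝓡 (2 * n + s)) x) :
    (inner ℝ (cov (S.ξ j) x v) (S.ξ k x) : ℝ) = -inner ℝ v (cov (S.ξ k) x (S.ξ j x)) := by
  have hx := mem_triv_baseSet (m := 2 * n + s) x
  have hX := smoothFieldAt_constField x (components x v) hx
  have h := hS.twoDEta_ξ j k hX
  have h0 : (fun y => S.η k y (S.ξ j y)) = fun _ : M => if k = j then (1 : ℝ) else 0 := by
    funext y; exact S.η_ξ k j y
  have h1 : (fun y => S.η k y (constField x (components x v) y)) =
      fun y => (inner ℝ (constField x (components x v) y) (S.ξ k y) : ℝ) := by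
    funext y; exact S.η_eq k y _
  rw [twoDEta, h0, h1, mvfderiv_const, hcov.mvfderiv_inner hX.diffFieldAt
    (S.ξ_smooth k x).diffFieldAt, hcov.mlieBracket_eq hX.diffFieldAt (S.ξ_smooth j x).diffFieldAt,
    S.η_eq, inner_sub_left, constField_components x hx] at h
  simp only [zero_apply] at h
  linarith

lemma cov_ξ_of_horizontal (hcov : IsLeviCivita cov) (hS : IsTransS cov S α β) (j : Fin s) {x : M}
    {v : TangentSpace (𝓡 (2 * n + s)) x} (hv : ∀ i, S.η i x v = 0) :
    cov (S.ξ j) x v = β j x • v - α j x • S.f x v := by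
  have hη : ∀ k, S.η k x (cov (S.ξ j) x v) = 0 := fun k => by
    -- `∇_{ξ_j} ξ_k` is vertical, hence orthogonal to the horizontal vector `v = -f (f v)`.
    have h1 : S.f x (cov (S.ξ k) x (S.ξ j x)) = 0 := by simp [hS.f_cov_ξ, S.f_ξ]
    have h2 := S.inner_f_left (S.f x v) (cov (S.ξ k) x (S.ξ j x))
    rw [h1, inner_zero_right, S.f_sq_of_horizontal hv, inner_neg_left] at h2
    rw [S.η_eq, hS.inner_cov_ξ_ξ hcov]
    linarith
  -- With `∇_v ξ_j` now known to be horizontal, it is recovered from `f (∇_v ξ_j)` by applying `-f`.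
  have h := S.f_sq_of_horizontal hη
  rw [hS.f_cov_ξ, map_sub, map_smul, map_smul, S.f_sq_of_horizontal hv, map_neg] at h
  rw [← neg_eq_iff_eq_neg.2 h]
  module

end IsTransS

end Structure

/-! ### The trans-`S` and metric identities along a curve. -/

section AlongCurve

variable {n s : ℕ} {M : Type*} [TopologicalSpace M]
  [ChartedSpace (EuclideanSpace ℝ (Fin (2 * n + s))) M] [IsManifold (𝓡 (2 * n + s)) ∞ M]
  [RiemannianBundle (fun x : M => TangentSpace (𝓡 (2 * n + s)) x)]
  {cov : Connection (2 * n + s) M} {S : FramedMetricStructure n s M} {α β : Fin s → M → ℝ}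
  {γ : ℝ → M} {J : Set ℝ} {V : (t : ℝ) → TangentSpace (𝓡 (2 * n + s)) (γ t)} {t : ℝ}

/-- Expanding `V` in coordinate fields reduces this to `IsTransS.cov_f_field`; summing the error
terms back uses the linearity built into `transTensor`. -/
lemma IsTransS.covAlong_f (hS : IsTransS cov S α β) (ht : t ∈ J)
    (hJ : UniqueDiffWithinAt ℝ J t) (hV : SmoothAlong γ J V) :
    covAlong cov γ J (fun τ => S.f (γ τ) (V τ)) t =
      S.f (γ t) (covAlong cov γ J V t) + transTensor S α β (γ t) (velocity γ J t) (V t) := by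
  obtain ⟨φ, φ', hφ, hexp⟩ := hV.exists_expansion ht
  have hγ := (hV.contMDiffOn t ht).mdifferentiableWithinAt (by simp)
  have hs : ∀ k, SmoothFieldAt (coordField (m := 2 * n + s) (γ t) k) (γ t) :=
    fun k => smoothFieldAt_constField _ _ (mem_triv_baseSet _)
  rw [covAlong_sum_smul cov ht hJ hγ hφ (fun k => (hs k).diffFieldAt) hexp,
    covAlong_sum_smul cov ht hJ hγ hφ (fun k => (S.smoothFieldAt_f (hs k)).diffFieldAt),
    hexp.self_of_nhdsWithin ht]
  · simp only [map_sum, map_add, map_smul, ← Finset.sum_add_distrib, hS.cov_f_field (hs _),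
      smul_add, add_assoc]
  · filter_upwards [hexp] with τ hτ
    simp only [hτ, map_sum, map_smul]

variable [IsContMDiffRiemannianBundle (𝓡 (2 * n + s)) ∞ (EuclideanSpace ℝ (Fin (2 * n + s)))
  (fun x : M => TangentSpace (𝓡 (2 * n + s)) x)]

-- The second factor is a field on `M`, which suffices because `T` is only ever paired with the
-- `ξ_i`.
set_option synthInstance.maxHeartbeats 200000 in
lemma IsLeviCivita.hasDerivWithinAt_inner (hcov : IsLeviCivita cov) (ht : t ∈ J)
    (hJ : UniqueDiffWithinAt ℝ J t) (hV : SmoothAlong γ J V) {Z : VField (2 * n + s) M}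
    (hZ : DiffFieldAt Z (γ t)) :
    HasDerivWithinAt (fun τ => (inner ℝ (V τ) (Z (γ τ)) : ℝ))
      (inner ℝ (covAlong cov γ J V t) (Z (γ t)) +
        inner ℝ (V t) (cov Z (γ t) (velocity γ J t))) J t := by
  obtain ⟨φ, φ', hφ, hexp⟩ := hV.exists_expansion ht
  have hγ := (hV.contMDiffOn t ht).mdifferentiableWithinAt (by simp)
  have hd := fun k => diffFieldAt_coordField (m := 2 * n + s) (γ t) k
  have hg : ∀ k, MDifferentiableAt (𝓡 (2 * n + s)) 𝓘(ℝ, ℝ)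
      (fun y => (inner ℝ (coordField (γ t) k y) (Z y) : ℝ)) (γ t) := fun k =>
    have : IsContMDiffRiemannianBundle (𝓡 (2 * n + s)) 1 (EuclideanSpace ℝ (Fin (2 * n + s)))
      (fun x : M => TangentSpace (𝓡 (2 * n + s)) x) := inferInstance
    (hd k).inner_bundle hZ
  rw [covAlong_sum_smul cov ht hJ hγ hφ hd hexp, hexp.self_of_nhdsWithin ht]
  have hev : (fun τ => (inner ℝ (V τ) (Z (γ τ)) : ℝ)) =ᶠ[𝓝[J] t]
      fun τ => ∑ k, φ k τ * (inner ℝ (coordField (γ t) k (γ τ)) (Z (γ τ)) : ℝ) := by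
    filter_upwards [hexp] with τ hτ
    simp only [hτ, sum_inner, real_inner_smul_left]
  refine HasDerivWithinAt.congr_of_eventuallyEq ?_ hev (hev.self_of_nhdsWithin ht)
  refine (HasDerivWithinAt.fun_sum fun k (_ : k ∈ Finset.univ) =>
    (hφ k).mul (hasDerivWithinAt_comp (hg k) hγ)).congr_deriv ?_
  simp only [hcov.mvfderiv_inner (hd _) hZ, sum_inner, inner_add_left, real_inner_smul_left,
    ← Finset.sum_add_distrib]
  exact Finset.sum_congr rfl fun k _ => by ring

end AlongCurve

/-! ### Derivatives of `T`, `fT` and vertical fields along a Legendre trajectory. -/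

section Trajectory

variable {n s : ℕ} {M : Type*} [TopologicalSpace M]
  [ChartedSpace (EuclideanSpace ℝ (Fin (2 * n + s))) M] [IsManifold (𝓡 (2 * n + s)) ∞ M]
  [RiemannianBundle (fun x : M => TangentSpace (𝓡 (2 * n + s)) x)]
  {cov : Connection (2 * n + s) M} {S : FramedMetricStructure n s M} {α β : Fin s → M → ℝ}
  {γ : ℝ → M} {J : Set ℝ} {q : ℝ} {t : ℝ}

lemma IsLegendre.inner_f_velocity (hγ : IsLegendre S γ J) (ht : t ∈ J) :
    (inner ℝ (S.f (γ t) (velocity γ J t)) (S.f (γ t) (velocity γ J t)) : ℝ) = 1 := by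
  rw [S.metric_f, hγ.1.unit t ht]
  simp [hγ.2 _ t ht]

lemma IsLegendre.f_velocity_ne_zero (hγ : IsLegendre S γ J) (ht : t ∈ J) :
    S.f (γ t) (velocity γ J t) ≠ 0 := fun h => by
  simpa [h] using hγ.inner_f_velocity ht

lemma IsLegendre.smoothAlong_velocity (hJ : UniqueDiffOn ℝ J) (hγ : IsLegendre S γ J) :
    SmoothAlong γ J (velocity (m := 2 * n + s) γ J) :=
  TransS.smoothAlong_velocity hJ hγ.1.smooth

/-- `(∇_T f)T` reduces to `∑ α_i ξ_i`, as `|fT| = 1`, `g(fT, T) = 0` and `η_i(T) = 0`, while `f(∇_T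
T) = -q f²T = qT`. -/
lemma IsTrajectory.covAlong_f_velocity (htraj : IsTrajectory cov S q γ J)
    (hS : IsTransS cov S α β) (hJ : UniqueDiffOn ℝ J) (hγ : IsLegendre S γ J) (ht : t ∈ J) :
    covAlong cov γ J (fun τ => S.f (γ τ) (velocity γ J τ)) t =
      ∑ i, α i (γ t) • S.ξ i (γ t) + q • velocity γ J t := by
  rw [hS.covAlong_f ht (hJ t ht) (hγ.smoothAlong_velocity hJ), htraj t ht, map_smul,
    S.f_sq_of_horizontal fun i => hγ.2 i t ht, transTensor_apply]
  simp only [hγ.inner_f_velocity ht, hγ.2 _ t ht, S.inner_f_self, one_smul, zero_smul, add_zero,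
    sub_zero, smul_zero, smul_neg, neg_smul, neg_neg]
  abel

variable [IsContMDiffRiemannianBundle (𝓡 (2 * n + s)) ∞ (EuclideanSpace ℝ (Fin (2 * n + s)))
  (fun x : M => TangentSpace (𝓡 (2 * n + s)) x)]

/-- Differentiate `g(T, ξ_i) = 0`: the term `g(-q fT, ξ_i)` is zero, and `g(T, β_i T - α_i fT) =
β_i`. -/
lemma IsTrajectory.β_eq_zero (htraj : IsTrajectory cov S q γ J) (hcov : IsLeviCivita cov)
    (hS : IsTransS cov S α β) (hJ : UniqueDiffOn ℝ J) (hγ : IsLegendre S γ J) (ht : t ∈ J)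
    (i : Fin s) : β i (γ t) = 0 := by
  have h1 := hcov.hasDerivWithinAt_inner ht (hJ t ht) (hγ.smoothAlong_velocity hJ)
    (S.ξ_smooth i (γ t)).diffFieldAt
  have h2 : HasDerivWithinAt
      (fun τ => (inner ℝ (velocity (m := 2 * n + s) γ J τ) (S.ξ i (γ τ)) : ℝ)) 0 J t :=
    (hasDerivWithinAt_const t J (0 : ℝ)).congr (fun τ hτ => by rw [← S.η_eq, hγ.2 i τ hτ])
      (by rw [← S.η_eq, hγ.2 i t ht])
  have h := (hJ t ht).eq_deriv _ h1 h2
  rw [htraj t ht, inner_smul_left, S.inner_f_ξ,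
    hS.cov_ξ_of_horizontal hcov i fun k => hγ.2 k t ht, inner_sub_right, inner_smul_right,
    inner_smul_right, hγ.1.unit t ht, real_inner_comm, S.inner_f_self] at h
  simpa using h

/-- `∇_T (∑ i, a_i ξ_i) = ∑ i, a_i' ξ_i - (∑ i, a_i α_i) f T` along a Legendre trajectory. -/
lemma IsTrajectory.covAlong_sum_ξ (htraj : IsTrajectory cov S q γ J) (hcov : IsLeviCivita cov)
    (hS : IsTransS cov S α β) (hJ : UniqueDiffOn ℝ J) (hγ : IsLegendre S γ J) (ht : t ∈ J)
    {a : Fin s → ℝ → ℝ} {a' : Fin s → ℝ} (ha : ∀ i, HasDerivWithinAt (a i) (a' i) J t) :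
    covAlong cov γ J (fun τ => ∑ i, a i τ • S.ξ i (γ τ)) t =
      ∑ i, a' i • S.ξ i (γ t) -
        (∑ i, a i t * α i (γ t)) • S.f (γ t) (velocity γ J t) := by
  rw [covAlong_sum_smul cov ht (hJ t ht) ((hγ.1.smooth t ht).mdifferentiableWithinAt (by simp)) ha
    (fun i => (S.ξ_smooth i (γ t)).diffFieldAt) (Filter.Eventually.of_forall fun _ => rfl),
    Finset.sum_smul, ← Finset.sum_sub_distrib]
  refine Finset.sum_congr rfl fun i _ => ?_
  rw [hS.cov_ξ_of_horizontal hcov i fun k => hγ.2 k t ht, htraj.β_eq_zero hcov hS hJ hγ ht]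
  module

omit [IsContMDiffRiemannianBundle (𝓡 (2 * n + s)) ∞ (EuclideanSpace ℝ (Fin (2 * n + s)))
  (fun x : M => TangentSpace (𝓡 (2 * n + s)) x)] in
lemma IsTransS.differentiableWithinAt_ratio (hS : IsTransS cov S α β) (hγ : IsLegendre S γ J)
    (ht : t ∈ J) (hα : ∃ i, α i (γ t) ≠ 0) (i : Fin s) :
    DifferentiableWithinAt ℝ (fun τ => α i (γ τ) / normα α γ τ) J t := by
  have hd : ∀ j, DifferentiableWithinAt ℝ (fun τ => α j (γ τ)) J t := fun j =>
    ((((hS.α_smooth j).comp_contMDiffOn hγ.1.smooth) t ht).contDiffWithinAt).differentiableWithinAt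
      (by simp)
  have hpos : 0 < ∑ j, α j (γ t) ^ 2 := by
    obtain ⟨k, hk⟩ := hα
    exact Finset.sum_pos' (fun j _ => sq_nonneg _) ⟨k, Finset.mem_univ _, by positivity⟩
  have hn : DifferentiableWithinAt ℝ (normα α γ) J t :=
    (DifferentiableWithinAt.fun_sum fun j _ => (hd j).pow 2).sqrt hpos.ne'
  exact (hd i).div hn (Real.sqrt_pos.2 hpos).ne'

end Trajectory

/-! ### Signs, norms and constancy on an interval. -/

section Auxiliary

lemma sign_neg_mul_self {q : ℝ} (hq : q ≠ 0) : Real.sign (-q) * Real.sign (-q) = 1 := by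
  rcases Real.sign_apply_eq_of_ne_zero (-q) (neg_ne_zero.2 hq) with h | h <;> simp [h]

lemma sign_neg_mul (q : ℝ) : Real.sign (-q) * q = -|q| := by
  rcases lt_trichotomy q 0 with h | h | h
  · rw [Real.sign_of_pos (by linarith), abs_of_neg h]; ring
  · simp [h]
  · rw [Real.sign_of_neg (by linarith), abs_of_pos h]; ring

lemma abs_mul_sign_neg (q : ℝ) : |q| * Real.sign (-q) = -q := by
  rcases lt_trichotomy q 0 with h | h | h
  · rw [Real.sign_of_pos (by linarith), abs_of_neg h]; ring
  · simp [h]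
  · rw [Real.sign_of_neg (by linarith), abs_of_pos h]; ring

/-- Reads each curvature off a relation `κ_j E_{j+1} = w`, with `E_{j+1}` a unit vector. -/
lemma eq_sqrt_of_smul_eq {E : Type*} [NormedAddCommGroup E] [InnerProductSpace ℝ E] {k : ℝ}
    {e w : E} (hk : 0 ≤ k) (he : (inner ℝ e e : ℝ) = 1) (h : k • e = w) :
    k = √(inner ℝ w w : ℝ) := by
  rw [← h, inner_smul_left, inner_smul_right, he]
  simp [Real.sqrt_mul_self hk]

lemma exists_eq_const_of_derivWithin_eq_zero {J : Set ℝ} (hJ : J.OrdConnected) {g : ℝ → ℝ}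
    (hg : DifferentiableOn ℝ g J) (h : ∀ t ∈ J, derivWithin g J t = 0) {t₀ t : ℝ} (ht₀ : t₀ ∈ J)
    (ht : t ∈ J) : g t = g t₀ := by
  refine hJ.convex.is_const_of_fderivWithin_eq_zero hg (fun x hx => ?_) ht ht₀
  ext
  simpa [derivWithin] using h x hx

end Auxiliary

lemma exists_α_ne_zero {s : ℕ} {M : Type*} {α : Fin s → M → ℝ} {γ : ℝ → M} {t : ℝ}
    (h : 0 < normα α γ t) : ∃ i, α i (γ t) ≠ 0 := by
  by_contra! h0
  simp [normα, h0] at h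

/-! ### The Frenet equations, one order at a time. -/

section Classification

variable {n s : ℕ} {M : Type*} [TopologicalSpace M]
  [ChartedSpace (EuclideanSpace ℝ (Fin (2 * n + s))) M] [IsManifold (𝓡 (2 * n + s)) ∞ M]
  [RiemannianBundle (fun x : M => TangentSpace (𝓡 (2 * n + s)) x)]
  {cov : Connection (2 * n + s) M} {S : FramedMetricStructure n s M} {α β : Fin s → M → ℝ}
  {γ : ℝ → M} {J : Set ℝ} {q : ℝ} {t : ℝ} {r : ℕ}
  {E : ℕ → (t : ℝ) → TangentSpace (𝓡 (2 * n + s)) (γ t)} {κ : ℕ → ℝ → ℝ}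

lemma IsTrajectory.covAlong_sign_f_velocity (htraj : IsTrajectory cov S q γ J)
    (hS : IsTransS cov S α β) (hJ : UniqueDiffOn ℝ J) (hγ : IsLegendre S γ J) (ht : t ∈ J) :
    covAlong cov γ J (fun τ => Real.sign (-q) • S.f (γ τ) (velocity γ J τ)) t =
      -(|q| • velocity γ J t) + Real.sign (-q) • ∑ i, α i (γ t) • S.ξ i (γ t) := by
  rw [covAlong_const_smul cov ht (hJ t ht) (S.smoothAlong_f (hγ.smoothAlong_velocity hJ)),
    htraj.covAlong_f_velocity hS hJ hγ ht, smul_add, smul_smul, sign_neg_mul, neg_smul]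
  abel

lemma IsTrajectory.isFrenetCurve (htraj : IsTrajectory cov S q γ J)
    (hS : IsTransS cov S α β) (hJ : UniqueDiffOn ℝ J) (hγ : IsLegendre S γ J) (hq : q ≠ 0)
    (hα : ∀ i, ∀ t ∈ J, α i (γ t) = 0) :
    IsFrenetCurve cov γ J 2
      (fun j t => if j = 1 then velocity γ J t
        else Real.sign (-q) • S.f (γ t) (velocity γ J t)) (fun _ _ => |q|) where
  unitSpeed := hγ.1
  one_le := one_le_two
  smooth j hj hj' := by
    have hv := hγ.smoothAlong_velocity hJ
    interval_cases j
    · simpa using hv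
    · simpa using (S.smoothAlong_f hv).const_smul (Real.sign (-q))
  orthonormal i j hi hi' hj hj' t ht := by
    have h1 := hγ.1.unit t ht
    have h2 := hγ.inner_f_velocity ht
    have h3 : (inner ℝ (S.f (γ t) (velocity γ J t)) (velocity γ J t) : ℝ) = 0 := S.inner_f_self _
    have h4 : (inner ℝ (velocity γ J t) (S.f (γ t) (velocity γ J t)) : ℝ) = 0 := by
      rw [real_inner_comm, h3]
    interval_cases i <;> interval_cases j <;>
      simp only [if_true, OfNat.ofNat_ne_one, OfNat.one_ne_ofNat, if_false, inner_smul_left,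
        inner_smul_right, h1, h2, h3, h4, mul_zero, mul_one]
    -- Only the pair `(2, 2)` remains, where `|δ fT|² = δ²`.
    exact sign_neg_mul_self hq
  κ_pos _ _ _ _ _ := abs_pos.2 hq
  tangent t _ := by simp
  frenet j hj hj' t ht := by
    interval_cases j
    · rw [if_pos rfl, if_neg (by norm_num), if_neg (by norm_num), zero_add, smul_smul,
        abs_mul_sign_neg]
      exact htraj t ht
    · have h := htraj.covAlong_sign_f_velocity hS hJ hγ ht
      simp only [hα _ t ht, zero_smul, Finset.sum_const_zero, smul_zero, add_zero] at h
      simpa using h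

/-- Order 1 would mean `∇_T T = 0`, but `-q fT` is nonzero. -/
lemma IsFrenetCurve.two_le (hF : IsFrenetCurve cov γ J r E κ) (htraj : IsTrajectory cov S q γ J)
    (hγ : IsLegendre S γ J) (hq : q ≠ 0) (ht : t ∈ J) : 2 ≤ r := by
  by_contra hr
  have hr1 : r = 1 := by have := hF.one_le; omega
  have h := hF.frenet 1 le_rfl hF.one_le t ht
  rw [covAlong_congr cov hF.tangent ht, htraj t ht] at h
  simp [hr1, hq, hγ.f_velocity_ne_zero ht] at h

lemma IsFrenetCurve.κ_one_smul (hF : IsFrenetCurve cov γ J r E κ)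
    (htraj : IsTrajectory cov S q γ J) (hr : 2 ≤ r) (ht : t ∈ J) :
    κ 1 t • E 2 t = -q • S.f (γ t) (velocity γ J t) := by
  have h := hF.frenet 1 le_rfl hF.one_le t ht
  rw [covAlong_congr cov hF.tangent ht, htraj t ht, if_pos rfl, if_neg (by omega)] at h
  simpa using h.symm

lemma IsFrenetCurve.κ_one_eq (hF : IsFrenetCurve cov γ J r E κ)
    (htraj : IsTrajectory cov S q γ J) (hγ : IsLegendre S γ J) (hr : 2 ≤ r) (ht : t ∈ J) :
    κ 1 t = |q| := by
  rw [eq_sqrt_of_smul_eq (hF.κ_pos 1 le_rfl hr t ht).le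
    (by simpa using hF.orthonormal 2 2 (by omega) hr (by omega) hr t ht)
    (hF.κ_one_smul htraj hr ht), inner_smul_left, inner_smul_right, hγ.inner_f_velocity ht]
  simp [← sq, Real.sqrt_sq_eq_abs]

lemma IsFrenetCurve.E_two_eq (hF : IsFrenetCurve cov γ J r E κ)
    (htraj : IsTrajectory cov S q γ J) (hγ : IsLegendre S γ J) (hq : q ≠ 0) (hr : 2 ≤ r)
    (ht : t ∈ J) : E 2 t = Real.sign (-q) • S.f (γ t) (velocity γ J t) := by
  have h := hF.κ_one_smul htraj hr ht
  rw [hF.κ_one_eq htraj hγ hr ht, ← abs_mul_sign_neg, ← smul_smul] at h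
  exact smul_right_injective _ (abs_ne_zero.2 hq) h

/-- Both expressions for `∇_T E_2` contain `-|q| T`; cancelling it leaves this identity. The `if`
covers `r = 2`, where it forces the `α_i` to vanish, together with `r ≥ 3`, where it yields `κ_2`
and `E_3`. -/
lemma IsFrenetCurve.κ_two_smul (hF : IsFrenetCurve cov γ J r E κ)
    (htraj : IsTrajectory cov S q γ J) (hS : IsTransS cov S α β) (hJ : UniqueDiffOn ℝ J)
    (hγ : IsLegendre S γ J) (hq : q ≠ 0) (hr : 2 ≤ r) (ht : t ∈ J) :
    (if 2 = r then 0 else κ 2 t • E 3 t) =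
      Real.sign (-q) • ∑ i, α i (γ t) • S.ξ i (γ t) := by
  have h := hF.frenet 2 one_le_two hr t ht
  rw [covAlong_congr cov (fun τ hτ => hF.E_two_eq htraj hγ hq hr hτ) ht,
    htraj.covAlong_sign_f_velocity hS hJ hγ ht, if_neg (by norm_num), hF.κ_one_eq htraj hγ hr ht,
    hF.tangent t ht] at h
  exact (add_left_cancel h).symm

lemma inner_sign_smul_sum_ξ (hq : q ≠ 0) (a : Fin s → ℝ) (x : M) :
    (inner ℝ (Real.sign (-q) • ∑ i, a i • S.ξ i x) (Real.sign (-q) • ∑ i, a i • S.ξ i x) : ℝ) =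
      ∑ i, a i ^ 2 := by
  rw [real_inner_smul_left, real_inner_smul_right, S.inner_sum_ξ, ← mul_assoc,
    sign_neg_mul_self hq, one_mul]
  simp only [sq]

lemma IsFrenetCurve.α_eq_zero (hF : IsFrenetCurve cov γ J 2 E κ)
    (htraj : IsTrajectory cov S q γ J) (hS : IsTransS cov S α β) (hJ : UniqueDiffOn ℝ J)
    (hγ : IsLegendre S γ J) (hq : q ≠ 0) (ht : t ∈ J) (i : Fin s) : α i (γ t) = 0 := by
  have h := hF.κ_two_smul htraj hS hJ hγ hq le_rfl ht
  have hδ := left_ne_zero_of_mul_eq_one (sign_neg_mul_self hq)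
  rw [if_pos rfl, eq_comm, smul_eq_zero_iff_right hδ, S.sum_ξ_eq_zero_iff] at h
  exact h i

lemma IsFrenetCurve.κ_two_eq (hF : IsFrenetCurve cov γ J r E κ)
    (htraj : IsTrajectory cov S q γ J) (hS : IsTransS cov S α β) (hJ : UniqueDiffOn ℝ J)
    (hγ : IsLegendre S γ J) (hq : q ≠ 0) (hr : 3 ≤ r) (ht : t ∈ J) :
    κ 2 t = normα α γ t := by
  have h := hF.κ_two_smul htraj hS hJ hγ hq (by omega) ht
  rw [if_neg (by omega)] at h
  rw [eq_sqrt_of_smul_eq (hF.κ_pos 2 one_le_two hr t ht).le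
    (by simpa using hF.orthonormal 3 3 (by omega) hr (by omega) hr t ht) h,
    inner_sign_smul_sum_ξ hq, normα]

lemma IsFrenetCurve.normα_pos (hF : IsFrenetCurve cov γ J r E κ)
    (htraj : IsTrajectory cov S q γ J) (hS : IsTransS cov S α β) (hJ : UniqueDiffOn ℝ J)
    (hγ : IsLegendre S γ J) (hq : q ≠ 0) (hr : 3 ≤ r) (ht : t ∈ J) : 0 < normα α γ t :=
  hF.κ_two_eq htraj hS hJ hγ hq hr ht ▸ hF.κ_pos 2 one_le_two hr t ht

lemma IsFrenetCurve.E_three_eq (hF : IsFrenetCurve cov γ J r E κ)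
    (htraj : IsTrajectory cov S q γ J) (hS : IsTransS cov S α β) (hJ : UniqueDiffOn ℝ J)
    (hγ : IsLegendre S γ J) (hq : q ≠ 0) (hr : 3 ≤ r) (ht : t ∈ J) :
    E 3 t = (Real.sign (-q) / normα α γ t) • ∑ i, α i (γ t) • S.ξ i (γ t) := by
  have h := hF.κ_two_smul htraj hS hJ hγ hq (by omega) ht
  have hpos := hF.normα_pos htraj hS hJ hγ hq hr ht
  rw [if_neg (by omega), hF.κ_two_eq htraj hS hJ hγ hq hr ht] at h
  rw [div_eq_inv_mul, ← smul_smul, ← h, inv_smul_smul₀ hpos.ne']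

lemma IsFrenetCurve.E_three_eq_ratio (hF : IsFrenetCurve cov γ J r E κ)
    (htraj : IsTrajectory cov S q γ J) (hS : IsTransS cov S α β) (hJ : UniqueDiffOn ℝ J)
    (hγ : IsLegendre S γ J) (hq : q ≠ 0) (hr : 3 ≤ r) (ht : t ∈ J) :
    E 3 t = ∑ i, (Real.sign (-q) * (α i (γ t) / normα α γ t)) • S.ξ i (γ t) := by
  rw [hF.E_three_eq htraj hS hJ hγ hq hr ht, Finset.smul_sum]
  exact Finset.sum_congr rfl fun i _ => by rw [smul_smul]; congr 1; ring

variable [IsContMDiffRiemannianBundle (𝓡 (2 * n + s)) ∞ (EuclideanSpace ℝ (Fin (2 * n + s)))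
  (fun x : M => TangentSpace (𝓡 (2 * n + s)) x)]

/-- Differentiate `E_3 = δ ∑ (α_i/|α|) ξ_i`: the `fT` part is exactly the Frenet term `-κ_2 E_2`, so
only the derivatives of the ratios survive. -/
lemma IsFrenetCurve.κ_three_smul (hF : IsFrenetCurve cov γ J r E κ)
    (htraj : IsTrajectory cov S q γ J) (hcov : IsLeviCivita cov) (hS : IsTransS cov S α β)
    (hJ : UniqueDiffOn ℝ J) (hγ : IsLegendre S γ J) (hq : q ≠ 0) (hr : 3 ≤ r) (ht : t ∈ J) :
    (if 3 = r then 0 else κ 3 t • E 4 t) =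
      Real.sign (-q) • ∑ i, derivRatio α γ J i t • S.ξ i (γ t) := by
  have hpos := hF.normα_pos htraj hS hJ hγ hq hr ht
  have h := hF.frenet 3 (by omega) hr t ht
  have hd := fun i => (hS.differentiableWithinAt_ratio hγ ht (exists_α_ne_zero hpos)
    i).hasDerivWithinAt.const_mul (Real.sign (-q))
  -- The coefficient of `-fT` in `∇_T E_3`, to be matched with `κ_2 δ`.
  have hsum : ∑ i, Real.sign (-q) * (α i (γ t) / normα α γ t) * α i (γ t) =
      normα α γ t * Real.sign (-q) := by
    have hsq : ∑ i, α i (γ t) ^ 2 = normα α γ t ^ 2 :=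
      (Real.sq_sqrt (Finset.sum_nonneg fun i _ => sq_nonneg _)).symm
    calc ∑ i, Real.sign (-q) * (α i (γ t) / normα α γ t) * α i (γ t)
        = Real.sign (-q) / normα α γ t * ∑ i, α i (γ t) ^ 2 := by
          rw [Finset.mul_sum]; exact Finset.sum_congr rfl fun i _ => by ring
      _ = normα α γ t * Real.sign (-q) := by rw [hsq]; field_simp
  rw [covAlong_congr cov (fun τ hτ => hF.E_three_eq_ratio htraj hS hJ hγ hq hr hτ) ht,
    htraj.covAlong_sum_ξ hcov hS hJ hγ ht hd, if_neg (by norm_num),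
    show κ (3 - 1) t = κ 2 t from rfl, show E (3 - 1) t = E 2 t from rfl,
    hF.κ_two_eq htraj hS hJ hγ hq hr ht, hF.E_two_eq htraj hγ hq (by omega) ht, hsum, smul_smul,
    sub_eq_neg_add] at h
  rw [← add_left_cancel h, Finset.smul_sum]
  exact Finset.sum_congr rfl fun i _ => by rw [smul_smul]; rfl

lemma IsFrenetCurve.κ_three_eq (hF : IsFrenetCurve cov γ J r E κ)
    (htraj : IsTrajectory cov S q γ J) (hcov : IsLeviCivita cov) (hS : IsTransS cov S α β)
    (hJ : UniqueDiffOn ℝ J) (hγ : IsLegendre S γ J) (hq : q ≠ 0) (hr : 4 ≤ r) (ht : t ∈ J) :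
    κ 3 t = √(∑ i, derivRatio α γ J i t ^ 2) := by
  have h := hF.κ_three_smul htraj hcov hS hJ hγ hq (by omega) ht
  rw [if_neg (by omega)] at h
  rw [eq_sqrt_of_smul_eq (hF.κ_pos 3 (by omega) hr t ht).le
    (by simpa using hF.orthonormal 4 4 (by omega) hr (by omega) hr t ht) h,
    inner_sign_smul_sum_ξ hq]

/-- For `r = 3` the third Frenet equation has no `E_4` term, so independence of the `ξ_i` makes
every ratio `α_i/|α|` have zero derivative on the interval. -/
lemma IsFrenetCurve.exists_const_of_three (hF : IsFrenetCurve cov γ J 3 E κ)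
    (htraj : IsTrajectory cov S q γ J) (hcov : IsLeviCivita cov) (hS : IsTransS cov S α β)
    (hJ : UniqueDiffOn ℝ J) (hJ' : J.OrdConnected) (hγ : IsLegendre S γ J) (hq : q ≠ 0)
    (ht : t ∈ J) :
    ∃ c : Fin s → ℝ, ∑ i, c i ^ 2 = 1 ∧ (∀ i, ∀ t ∈ J, α i (γ t) = c i * normα α γ t) ∧
      ∀ t ∈ J, E 3 t = Real.sign (-q) • ∑ i, c i • S.ξ i (γ t) := by
  have hpos := fun τ (hτ : τ ∈ J) => hF.normα_pos htraj hS hJ hγ hq le_rfl hτ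
  have hc : ∀ i, ∀ τ ∈ J, α i (γ τ) / normα α γ τ = α i (γ t) / normα α γ t := fun i τ hτ => by
    refine exists_eq_const_of_derivWithin_eq_zero hJ' (g := fun τ => α i (γ τ) / normα α γ τ)
      (fun u hu => hS.differentiableWithinAt_ratio hγ hu (exists_α_ne_zero (hpos u hu)) i)
      (fun u hu => ?_) ht hτ
    have h := hF.κ_three_smul htraj hcov hS hJ hγ hq le_rfl hu
    have hδ := left_ne_zero_of_mul_eq_one (sign_neg_mul_self hq)
    rw [if_pos rfl, eq_comm, smul_eq_zero_iff_right hδ, S.sum_ξ_eq_zero_iff] at h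
    exact h i
  -- The constants are the ratios at the base point `t`.
  refine ⟨fun i => α i (γ t) / normα α γ t, ?_, fun i τ hτ => ?_, fun τ hτ => ?_⟩
  · have hsq : ∑ i, α i (γ t) ^ 2 = normα α γ t ^ 2 :=
      (Real.sq_sqrt (Finset.sum_nonneg fun i _ => sq_nonneg _)).symm
    simp only [div_pow]
    rw [← Finset.sum_div, hsq, div_self (pow_ne_zero 2 (hpos t ht).ne')]
  · beta_reduce
    rw [← hc i τ hτ, div_mul_cancel₀ _ (hpos τ hτ).ne']
  · rw [hF.E_three_eq_ratio htraj hS hJ hγ hq le_rfl hτ, Finset.smul_sum]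
    exact Finset.sum_congr rfl fun i _ => by rw [hc i τ hτ, smul_smul]

end Classification

end TransS

end


theorem mainTheorem1 {n s : ℕ} {M : Type*} [TopologicalSpace M]
    [ChartedSpace (EuclideanSpace ℝ (Fin (2 * n + s))) M] [IsManifold (𝓡 (2 * n + s)) ∞ M]
    [RiemannianBundle (fun x : M => TangentSpace (𝓡 (2 * n + s)) x)]
    [IsContMDiffRiemannianBundle (𝓡 (2 * n + s)) ∞ (EuclideanSpace ℝ (Fin (2 * n + s)))
      (fun x : M => TangentSpace (𝓡 (2 * n + s)) x)]
    (cov : TransS.Connection (2 * n + s) M) (hcov : TransS.IsLeviCivita cov)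
    (S : TransS.FramedMetricStructure n s M) (α β : Fin s → M → ℝ)
    (hS : TransS.IsTransS cov S α β)
    (J : Set ℝ) (hJ : J.OrdConnected) (hJ' : J.Nontrivial)
    (γ : ℝ → M) (hγ : TransS.IsLegendre S γ J)
    (q : ℝ) (hq : q ≠ 0) (htraj : TransS.IsTrajectory cov S q γ J) :
    -- all `β_i` vanish along the curve
    (∀ i, ∀ t ∈ J, β i (γ t) = 0) ∧
    -- if all `α_i` vanish along the curve, it is a circle with frame `{T, δ f T}`
    ((∀ i, ∀ t ∈ J, α i (γ t) = 0) →
      TransS.IsFrenetCurve cov γ J 2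
        (fun j t => if j = 1 then TransS.velocity γ J t
          else Real.sign (-q) • S.f (γ t) (TransS.velocity γ J t))
        (fun _ _ => |q|)) ∧
    -- the classification
    (∀ (r : ℕ) (E : ℕ → (t : ℝ) → TangentSpace (𝓡 (2 * n + s)) (γ t)) (κ : ℕ → ℝ → ℝ),
      TransS.IsFrenetCurve cov γ J r E κ →
      2 ≤ r ∧
      (∀ t ∈ J, κ 1 t = |q|) ∧
      (∀ t ∈ J, E 2 t = Real.sign (-q) • S.f (γ t) (TransS.velocity γ J t)) ∧
      ((r = 2 ∧ ∀ i, ∀ t ∈ J, α i (γ t) = 0) ∨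
        (3 ≤ r ∧
          (∀ t ∈ J, ∃ i, α i (γ t) ≠ 0) ∧
          (∀ t ∈ J, κ 2 t = √(∑ i, α i (γ t) ^ 2)) ∧
          (∀ t ∈ J, E 3 t =
            (Real.sign (-q) / √(∑ i, α i (γ t) ^ 2)) • ∑ i, α i (γ t) • S.ξ i (γ t)) ∧
          (4 ≤ r → ∀ t ∈ J,
            κ 3 t = √(∑ i, TransS.derivRatio α γ J i t ^ 2) ∧
            κ 3 t • E 4 t =
              Real.sign (-q) • ∑ i, TransS.derivRatio α γ J i t • S.ξ i (γ t)) ∧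
          (r = 3 → ∃ c : Fin s → ℝ, ∑ i, c i ^ 2 = 1 ∧
            (∀ i, ∀ t ∈ J, α i (γ t) = c i * √(∑ j, α j (γ t) ^ 2)) ∧
            (∀ t ∈ J, E 3 t = Real.sign (-q) • ∑ i, c i • S.ξ i (γ t)))))) := by
  have hJu := TransS.uniqueDiffOn_of_ordConnected hJ hJ'
  -- A point of the curve is needed to bound `r` from below, and again as base point for the
  -- constants when `r = 3`.
  obtain ⟨t₀, ht₀⟩ := hJ'.nonempty
  refine ⟨fun i t ht => htraj.β_eq_zero hcov hS hJu hγ ht i,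
    fun hα => htraj.isFrenetCurve hS hJu hγ hq hα, fun r E κ hF => ?_⟩
  have hr := hF.two_le htraj hγ hq ht₀
  refine ⟨hr, fun t ht => hF.κ_one_eq htraj hγ hr ht,
    fun t ht => hF.E_two_eq htraj hγ hq hr ht, ?_⟩
  -- The two alternatives exclude each other through the value of `r`.
  rcases hr.eq_or_lt with rfl | hr3
  · exact Or.inl ⟨rfl, fun i t ht => hF.α_eq_zero htraj hS hJu hγ hq ht i⟩
  refine Or.inr ⟨hr3,
    fun t ht => TransS.exists_α_ne_zero (hF.normα_pos htraj hS hJu hγ hq hr3 ht),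
    fun t ht => hF.κ_two_eq htraj hS hJu hγ hq hr3 ht,
    fun t ht => hF.E_three_eq htraj hS hJu hγ hq hr3 ht, fun hr4 t ht => ?_, ?_⟩
  · refine ⟨hF.κ_three_eq htraj hcov hS hJu hγ hq hr4 ht, ?_⟩
    rw [← hF.κ_three_smul htraj hcov hS hJu hγ hq hr3 ht, if_neg (by omega)]
  · rintro rfl
    exact hF.exists_const_of_three htraj hcov hS hJu hJ hγ hq ht₀
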